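/- \textbf{Definitions.} A \emph{subordination} between boolean algebras $A$ and $B$ is a relation $S\subseteq A\times B$ such that $0\mathrel{S}0$ and $1\mathrel{S}1$; $a,b\mathrel{S}c$ implies $(a\vee b)\mathrel{S}c$; $a\mathrel{S}c,d$ implies $a\mathrel{S}(c\wedge d)$; and $a\le b\mathrel{S}c\le d$ implies $a\mathrel{S}d$. An \emph{$\mathsf{S5}$-subordination algebra} $(B,S)$ is a boolean algebra $B$ with a subordination $S\subseteq B\times B$ such that $a\mathrel{S}b$ implies $a\le b$, $\neg b\mathrel{S}\neg a$, and $a\mathrel{S}c\mathrel{S}b$ for some $c\in B$. It is a \emph{de Vries algebra} if moreover $B$ is complete and for each $a\ne 0$ there is $b\neq 0$ with $b\mathrel{S}a$. $\mathsf{SubS5^S}$ is the category of $\mathsf{S5}$-subordination algebras, whose morphisms $(B_1,S_1)\to(B_2,S_2)$ are the compatible subordinations, i.e. the subordinations $T\subseteq B_1\times B_2$ with $S_2\circ T=T=T\circ S_1$; composition is relation composition and the identity of $(B,S)$ is $S$. $\mathsf{DeV^S}$ is its full subcategory of de Vries algebras, and $\Delta\colon\mathsf{DeV^S}\to\mathsf{SubS5^S}$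 is the inclusion. For such a $T$ let $\widehat T\subseteq B_2\times B_1$ be given by $b\mathrel{\widehat T}a$ iff $\neg a\mathrel{T}\neg b$; $T$ is \emph{functional} if $\widehat T\circ T\subseteq S_1$ and $S_2\subseteq T\circ\widehat T$. $\mathsf{SubS5^F}$ and $\mathsf{DeV^F}$ are the wide subcategories of $\mathsf{SubS5^S}$ and $\mathsf{DeV^S}$ whose morphisms are the functional ones. In a frame, $a\prec b$ means $a^*\vee b=1$, where $a^*$ is the pseudocomplement of $a$. A frame is \emph{compact} if $1$ is a compact element and \emph{regular} if $a=\bigvee\{x\mid x\prec a\}$ for each $a$. $\mathsf{KRFrm^P}$ is the category of compact regular frames and preframe homomorphisms (maps preserving finite meets and directed joins), and $\mathsf{KRFrm}$ is its wide subcategory whose morphisms are the frame homomorphisms (maps preserving finite meets and arbitrary joins). For an $\mathsf{S5}$-subordination algebra $\mathbf B=(B,S)$, let $\mathcal{RI}(\mathbf B)$ be the frame, ordered by inclusion, of round ideals of $\mathbf B$, i.e. ideals $I$ of $B$ such that each $a\in I$ satisfies $a\mathrel{S}b$ for some $b\in I$; for a morphism $T\colon\mathbf B_1\to\mathbf B_2$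 of $\mathsf{SubS5^S}$ let $\mathcal{RI}(T)(I)=T^{-1}[I]$. For a compact regular frame $L$, let $\mathfrak B L=\{a\in L\mid a=a^{**}\}$ with the restriction of $\prec$; for a preframe homomorphism $\Box\colon L\to M$ let $b\mathrel{\mathfrak B(\Box)}a$ iff $b\prec\Box a$, for $b\in\mathfrak BM$ and $a\in\mathfrak BL$. Then $\mathcal{RI}\colon\mathsf{SubS5^S}\to\mathsf{KRFrm^P}$ and $\mathfrak B\colon\mathsf{KRFrm^P}\to\mathsf{DeV^S}$ are contravariant functors. The functors $\mathcal{RI}$ and $\Delta\circ\mathfrak B$, with the natural isomorphisms $Q_{\mathbf B}\colon\mathbf B\to\mathfrak B\,\mathcal{RI}(\mathbf B)$, $a\mathrel{Q_{\mathbf B}}I$ iff $a\in I$, and $f_L\colon L\to\mathcal{RI}(\mathfrak BL)$, $f_L(a)=\{b\in\mathfrak BL\mid b\prec a\}$, form a dual equivalence between $\mathsf{SubS5^S}$ and $\mathsf{KRFrm^P}$; likewise $\mathcal{RI}\circ\Delta$ and $\mathfrak B$ form a dual equivalence between $\mathsf{DeV^S}$ and $\mathsf{KRFrm^P}$. \textbf{Theorem.}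 (1) The dual equivalence between $\mathsf{SubS5^S}$ and $\mathsf{KRFrm^P}$ formed by $\mathcal{RI}$ and $\Delta\circ\mathfrak B$ restricts to a dual equivalence between their wide subcategories $\mathsf{SubS5^F}$ and $\mathsf{KRFrm}$. (2) The dual equivalence between $\mathsf{DeV^S}$ and $\mathsf{KRFrm^P}$ formed by $\mathcal{RI}\circ\Delta$ and $\mathfrak B$ restricts to a dual equivalence between their wide subcategories $\mathsf{DeV^F}$ and $\mathsf{KRFrm}$. Here ``restricts'' means that the contravariant functors and the natural isomorphisms of the dual equivalence between the wide subcategories are the restrictions of those of the given dual equivalence. -/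

import Mathlib

open CategoryTheory

universe u

/-! ### S5-subordination algebras and compatible subordinations -/

/-- A relation `S` between boolean algebras is a subordination. -/
structure IsSubordination {A B : Type u} [BooleanAlgebra A] [BooleanAlgebra B]
    (S : A → B → Prop) : Prop where
  bot_bot : S ⊥ ⊥
  top_top : S ⊤ ⊤
  sup_left : ∀ {a b : A} {c : B}, S a c → S b c → S (a ⊔ b) c
  inf_right : ∀ {a : A} {c d : B}, S a c → S a d → S a (c ⊓ d)
  mono : ∀ {a b : A} {c d : B}, a ≤ b → S b c → c ≤ d → S a d

/-- An S5-subordination algebra: a boolean algebra with an S5-subordination `rel` on it. -/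
structure SubS5S : Type (u + 1) where
  carrier : Type u
  [str : BooleanAlgebra carrier]
  rel : carrier → carrier → Prop
  isSubordination : IsSubordination rel
  le_of_rel : ∀ {a b : carrier}, rel a b → a ≤ b
  compl_rel_compl : ∀ {a b : carrier}, rel a b → rel bᶜ aᶜ
  exists_between : ∀ {a b : carrier}, rel a b → ∃ c, rel a c ∧ rel c b

attribute [instance] SubS5S.str

/-- Compatible subordinations `T : (B₁, S₁) → (B₂, S₂)`, i.e. `S₂ ∘ T = T = T ∘ S₁`. Note that
`Relation.Comp T S` relates `a` to `c` iff there is `b` with `T a b` and `S b c`, so that it is the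
composite relation `S ∘ T`. -/
@[ext]
structure CompatSub (B₁ B₂ : SubS5S.{u}) : Type u where
  rel : B₁.carrier → B₂.carrier → Prop
  isSubordination : IsSubordination rel
  comp_right : Relation.Comp rel B₂.rel = rel
  comp_left : Relation.Comp B₁.rel rel = rel

namespace CompatSub

variable {B₁ B₂ B₃ B₄ : SubS5S.{u}}

theorem right (T : CompatSub B₁ B₂) {a : B₁.carrier} {b : B₂.carrier} :
    T.rel a b ↔ ∃ c, T.rel a c ∧ B₂.rel c b := by
  conv_lhs => rw [← T.comp_right]
  rfl

theorem left (T : CompatSub B₁ B₂) {a : B₁.carrier} {b : B₂.carrier} :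
    T.rel a b ↔ ∃ c, B₁.rel a c ∧ T.rel c b := by
  conv_lhs => rw [← T.comp_left]
  rfl

/-- The identity morphism on `(B, S)` is `S`. -/
def id (B : SubS5S.{u}) : CompatSub B B where
  rel := B.rel
  isSubordination := B.isSubordination
  comp_right := by
    ext a b
    exact ⟨fun ⟨c, h, h'⟩ => B.isSubordination.mono (B.le_of_rel h) h' le_rfl,
      fun h => B.exists_between h⟩
  comp_left := by
    ext a b
    exact ⟨fun ⟨c, h, h'⟩ => B.isSubordination.mono (B.le_of_rel h) h' le_rfl,
      fun h => B.exists_between h⟩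

/-- Composition of morphisms is composition of relations. -/
def comp (T : CompatSub B₁ B₂) (U : CompatSub B₂ B₃) : CompatSub B₁ B₃ where
  rel := Relation.Comp T.rel U.rel
  isSubordination :=
    { bot_bot := ⟨⊥, T.isSubordination.bot_bot, U.isSubordination.bot_bot⟩
      top_top := ⟨⊤, T.isSubordination.top_top, U.isSubordination.top_top⟩
      sup_left := fun ⟨x, h, h'⟩ ⟨y, k, k'⟩ =>
        ⟨x ⊔ y, T.isSubordination.sup_left (T.isSubordination.mono le_rfl h le_sup_left)
          (T.isSubordination.mono le_rfl k le_sup_right), U.isSubordination.sup_left h' k'⟩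
      inf_right := fun ⟨x, h, h'⟩ ⟨y, k, k'⟩ =>
        ⟨x ⊓ y, T.isSubordination.inf_right h k, U.isSubordination.inf_right
          (U.isSubordination.mono inf_le_left h' le_rfl)
          (U.isSubordination.mono inf_le_right k' le_rfl)⟩
      mono := fun h ⟨x, k, k'⟩ h' =>
        ⟨x, T.isSubordination.mono h k le_rfl, U.isSubordination.mono le_rfl k' h'⟩ }
  comp_right := by rw [Relation.comp_assoc, U.comp_right]
  comp_left := by rw [← Relation.comp_assoc, T.comp_left]

end CompatSub

/-- The category of S5-subordination algebras and compatible subordinations. -/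
instance SubS5S.category : Category.{u} SubS5S.{u} where
  Hom := CompatSub
  id := CompatSub.id
  comp := CompatSub.comp
  id_comp T := CompatSub.ext T.comp_left
  comp_id T := CompatSub.ext T.comp_right
  assoc _ _ _ := CompatSub.ext Relation.comp_assoc

/-- De Vries algebras: `(B, S)` satisfies the compingent law and `B` is complete. -/
def isDeVries : ObjectProperty SubS5S.{u} := fun B =>
  (∀ a : B.carrier, a ≠ ⊥ → ∃ b : B.carrier, b ≠ ⊥ ∧ B.rel b a) ∧
    ∀ s : Set B.carrier, ∃ x, IsLUB s x

/-- The full subcategory of de Vries algebras. -/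
abbrev DeVS : Type (u + 1) := isDeVries.{u}.FullSubcategory

/-! ### Functional morphisms -/

/-- The relation `T̂` given by `b T̂ a` iff `¬a T ¬b`. -/
def hat {A B : Type u} [BooleanAlgebra A] [BooleanAlgebra B] (T : A → B → Prop) : B → A → Prop :=
  fun b a => T aᶜ bᶜ

/-- A morphism `T` is functional if `T̂ ∘ T ⊆ S₁` and `S₂ ⊆ T ∘ T̂`. -/
def functional : MorphismProperty SubS5S.{u} := fun B₁ B₂ T =>
  (∀ a a' : B₁.carrier, Relation.Comp (CompatSub.rel T) (hat (CompatSub.rel T)) a a' →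
      B₁.rel a a') ∧
    ∀ b b' : B₂.carrier, B₂.rel b b' →
      Relation.Comp (hat (CompatSub.rel T)) (CompatSub.rel T) b b'

instance functional_isMultiplicative : functional.{u}.IsMultiplicative where
  id_mem B := by
    refine ⟨fun a a' ⟨c, h, h'⟩ => ?_, fun b b' h => ?_⟩
    · have h'' := B.compl_rel_compl h'
      rw [compl_compl, compl_compl] at h''
      exact B.isSubordination.mono (B.le_of_rel h) h'' le_rfl
    · obtain ⟨c, h, h'⟩ := B.exists_between h
      exact ⟨c, B.compl_rel_compl h, h'⟩
  comp_mem {B₁ B₂ B₃} T U hT hU := by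
    refine ⟨fun a a' ⟨y, ⟨x, h, h'⟩, ⟨x', k', k⟩⟩ => ?_, fun b b' h => ?_⟩
    · have hx : B₂.rel x x'ᶜ := hU.1 x x'ᶜ ⟨y, h', by simpa [hat] using k⟩
      refine hT.1 a a' ⟨x'ᶜ, (CompatSub.right T).2 ⟨x, h, hx⟩, by simpa [hat] using k'⟩
    · obtain ⟨x, hx, hx'⟩ := hU.2 _ _ h
      obtain ⟨x₁, h₁, h₂⟩ := (CompatSub.left U).1 hx'
      obtain ⟨y, hy, hy'⟩ := hT.2 _ _ h₁
      exact ⟨y, ⟨xᶜ, hy, hx⟩, ⟨x₁, hy', h₂⟩⟩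

/-- The wide subcategory of functional morphisms. -/
abbrev SubS5F : Type (u + 1) := WideSubcategory functional.{u}

/-- The wide subcategory of functional morphisms between de Vries algebras. -/
abbrev DeVF : Type (u + 1) :=
  WideSubcategory (functional.{u}.inverseImage isDeVries.{u}.ι)

/-! ### Compact regular frames -/

/-- `a` is well inside `b`. -/
def WellInside {L : Type u} [Order.Frame L] (a b : L) : Prop := aᶜ ⊔ b = ⊤

/-- Compact regular frames. -/
structure KRFrmP : Type (u + 1) where
  carrier : Type u
  [str : Order.Frame carrier]
  isCompact : IsCompactElement (⊤ : carrier)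
  isRegular : ∀ a : carrier, a = sSup {x | WellInside x a}

attribute [instance] KRFrmP.str

/-- Preframe homomorphisms: maps that preserve finite meets and directed joins. -/
@[ext]
structure PreframeHom (L M : KRFrmP.{u}) : Type u where
  toFun : L.carrier → M.carrier
  map_top : toFun ⊤ = ⊤
  map_inf : ∀ a b, toFun (a ⊓ b) = toFun a ⊓ toFun b
  map_sSup : ∀ s : Set L.carrier, s.Nonempty → DirectedOn (· ≤ ·) s →
    toFun (sSup s) = sSup (toFun '' s)

theorem PreframeHom.monotone {L M : KRFrmP.{u}} (f : PreframeHom L M) : Monotone f.toFun := by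
  intro a b h
  rw [← inf_eq_left, ← f.map_inf, inf_eq_left.2 h]

theorem DirectedOn.image_mono {A B : Type u} [Preorder A] [Preorder B] {s : Set A}
    (hs : DirectedOn (· ≤ ·) s) {f : A → B} (hf : Monotone f) : DirectedOn (· ≤ ·) (f '' s) := by
  rintro _ ⟨a, ha, rfl⟩ _ ⟨b, hb, rfl⟩
  obtain ⟨c, hc, hac, hbc⟩ := hs a ha b hb
  exact ⟨f c, ⟨c, hc, rfl⟩, hf hac, hf hbc⟩

/-- The category of compact regular frames and preframe homomorphisms. -/
instance KRFrmP.category : Category.{u} KRFrmP.{u} where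
  Hom := PreframeHom
  id L :=
    { toFun := fun a => a
      map_top := rfl
      map_inf := fun _ _ => rfl
      map_sSup := fun s _ _ => by rw [Set.image_id'] }
  comp {L M N} f g :=
    { toFun := fun a => g.toFun (f.toFun a)
      map_top := by rw [f.map_top, g.map_top]
      map_inf := fun a b => by rw [f.map_inf, g.map_inf]
      map_sSup := fun s hs hd => by
        rw [f.map_sSup s hs hd, g.map_sSup _ (hs.image _)
          (DirectedOn.image_mono hd f.monotone), Set.image_image] }

/-- A preframe homomorphism is a frame homomorphism if it preserves finite meets and arbitrary
joins. -/
def isFrameHom : MorphismProperty KRFrmP.{u} := fun L M f =>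
  ∃ g : FrameHom L.carrier M.carrier, ∀ a, g a = PreframeHom.toFun f a

instance isFrameHom_isMultiplicative : isFrameHom.{u}.IsMultiplicative where
  id_mem L := ⟨FrameHom.id _, fun _ => rfl⟩
  comp_mem {L M N} f g hf hg := by
    obtain ⟨f', hf⟩ := hf
    obtain ⟨g', hg⟩ := hg
    exact ⟨g'.comp f', fun a => by
      change g' (f' a) = PreframeHom.toFun g (PreframeHom.toFun f a); rw [hf, hg]⟩

/-- The category of compact regular frames and frame homomorphisms, as a wide subcategory of
the category of compact regular frames and preframe homomorphisms. -/
abbrev KRFrm : Type (u + 1) := WideSubcategory isFrameHom.{u}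

/-! ### Round ideals -/

/-- The round ideals of an S5-subordination algebra, ordered by inclusion. -/
def RoundIdeal (B : SubS5S.{u}) : Type u :=
  {I : Order.Ideal B.carrier // ∀ a ∈ I, ∃ b ∈ I, B.rel a b}

namespace RoundIdeal

variable {B B₁ B₂ B₃ : SubS5S.{u}}

instance : PartialOrder (RoundIdeal B) := Subtype.partialOrder _

instance : Membership B.carrier (RoundIdeal B) := ⟨fun I a => a ∈ I.1⟩

theorem le_def {I J : RoundIdeal B} : I ≤ J ↔ ∀ a ∈ I, a ∈ J := Iff.rfl

theorem ext {I J : RoundIdeal B} (h : ∀ a, a ∈ I ↔ a ∈ J) : I = J :=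
  le_antisymm (fun a => (h a).1) (fun a => (h a).2)

theorem mem_of_le {I : RoundIdeal B} {a b : B.carrier} (h : a ≤ b) (hb : b ∈ I) : a ∈ I :=
  I.1.lower h hb

theorem sup_mem {I : RoundIdeal B} {a b : B.carrier} (ha : a ∈ I) (hb : b ∈ I) : a ⊔ b ∈ I :=
  Order.Ideal.sup_mem ha hb

theorem bot_mem (I : RoundIdeal B) : ⊥ ∈ I := Order.Ideal.bot_mem I.1

theorem mem_of_rel {I : RoundIdeal B} {a b : B.carrier} (h : B.rel a b) (hb : b ∈ I) : a ∈ I :=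
  mem_of_le (B.le_of_rel h) hb

/-- An ideal given by closure properties. -/
def mkIdeal {A : Type u} [BooleanAlgebra A] (p : A → Prop) (bot : p ⊥)
    (sup : ∀ a b, p a → p b → p (a ⊔ b)) (mono : ∀ a b, a ≤ b → p b → p a) : Order.Ideal A where
  carrier := {a | p a}
  lower' := fun _ _ h hb => mono _ _ h hb
  nonempty' := ⟨⊥, bot⟩
  directed' := fun a ha b hb => ⟨a ⊔ b, sup a b ha hb, le_sup_left, le_sup_right⟩

/-- For a compatible subordination `T : B₁ → B₂` and an ideal `I` of `B₂`, the set `T⁻¹[I]`,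
which is a round ideal of `B₁`. -/
def preimage (T : CompatSub B₁ B₂) (I : Order.Ideal B₂.carrier) : RoundIdeal B₁ :=
  ⟨mkIdeal (fun a => ∃ b ∈ I, T.rel a b) ⟨⊥, I.bot_mem, T.isSubordination.bot_bot⟩
    (fun _ _ ⟨b, hb, h⟩ ⟨b', hb', h'⟩ => ⟨b ⊔ b', Order.Ideal.sup_mem hb hb',
      T.isSubordination.sup_left (T.isSubordination.mono le_rfl h le_sup_left)
        (T.isSubordination.mono le_rfl h' le_sup_right)⟩)
    (fun _ _ hle ⟨b, hb, h⟩ => ⟨b, hb, T.isSubordination.mono hle h le_rfl⟩),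
   fun _ ⟨b, hb, h⟩ =>
    have ⟨c, hc, hc'⟩ := T.left.1 h
    ⟨c, ⟨b, hb, hc'⟩, hc⟩⟩

theorem mem_preimage {T : CompatSub B₁ B₂} {I : Order.Ideal B₂.carrier} {a : B₁.carrier} :
    a ∈ preimage T I ↔ ∃ b ∈ I, T.rel a b := Iff.rfl

/-- The round ideal `S⁻¹[b]`. -/
def below (b : B.carrier) : RoundIdeal B := preimage (CompatSub.id B) (Order.Ideal.principal b)

theorem mem_below {a b : B.carrier} : a ∈ below b ↔ B.rel a b :=
  ⟨fun ⟨_, hc, h⟩ => B.isSubordination.mono le_rfl h hc, fun h => ⟨b, le_rfl, h⟩⟩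

instance : SupSet (RoundIdeal B) :=
  ⟨fun s => preimage (CompatSub.id B) (sSup (Subtype.val '' s))⟩

theorem isLUB_sSup (s : Set (RoundIdeal B)) : IsLUB s (sSup s) := by
  refine ⟨fun I hI a ha => ?_, fun J hJ a ⟨b, hb, h⟩ => ?_⟩
  · obtain ⟨b, hb, h⟩ := I.2 a ha
    have hI' : I.1 ∈ Subtype.val '' s := ⟨I, hI, rfl⟩
    exact ⟨b, le_sSup hI' hb, h⟩
  · have : sSup (Subtype.val '' s) ≤ J.1 := sSup_le (by rintro _ ⟨I, hI, rfl⟩; exact hJ hI)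
    exact mem_of_rel h (this hb)

/-- Membership in a join may be tested on ideals, round or not. -/
theorem sSup_sub {s : Set (RoundIdeal B)} (K : Order.Ideal B.carrier)
    (h : ∀ I ∈ s, ∀ a ∈ I, a ∈ K) {a : B.carrier} (ha : a ∈ sSup s) : a ∈ K := by
  obtain ⟨b, hb, hab⟩ := ha
  have : sSup (Subtype.val '' s) ≤ K := sSup_le (by rintro _ ⟨I, hI, rfl⟩; exact h I hI)
  exact K.lower (B.le_of_rel hab) (this hb)

instance : CompleteLattice (RoundIdeal B) :=
  { completeLatticeOfSup (RoundIdeal B) isLUB_sSup with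
    inf := fun I J => ⟨mkIdeal (fun a => a ∈ I ∧ a ∈ J) ⟨I.bot_mem, J.bot_mem⟩
      (fun _ _ h h' => ⟨sup_mem h.1 h'.1, sup_mem h.2 h'.2⟩)
      (fun _ _ hle h => ⟨mem_of_le hle h.1, mem_of_le hle h.2⟩),
      fun a ⟨h, h'⟩ =>
        have ⟨b, hb, hab⟩ := I.2 a h
        have ⟨c, hc, hac⟩ := J.2 a h'
        ⟨b ⊓ c, ⟨mem_of_le (I := I) inf_le_left hb, mem_of_le (I := J) inf_le_right hc⟩,
          B.isSubordination.inf_right hab hac⟩⟩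
    inf_le_left := fun _ _ _ h => h.1
    inf_le_right := fun _ _ _ h => h.2
    le_inf := fun _ _ _ h h' _ ha => ⟨h ha, h' ha⟩
    top := ⟨⊤, fun _ _ => ⟨⊤, trivial, B.isSubordination.mono le_top
      B.isSubordination.top_top le_rfl⟩⟩
    le_top := fun _ _ _ => trivial }

theorem mem_inf {I J : RoundIdeal B} {a : B.carrier} : a ∈ I ⊓ J ↔ a ∈ I ∧ a ∈ J := Iff.rfl

theorem mem_top (a : B.carrier) : a ∈ (⊤ : RoundIdeal B) := trivial

theorem mem_sSup_of_mem {s : Set (RoundIdeal B)} {I : RoundIdeal B} (hI : I ∈ s) {a : B.carrier}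
    (ha : a ∈ I) : a ∈ sSup s := (isLUB_sSup s).1 hI ha

/-- Directed joins of round ideals are unions. -/
theorem mem_sSup_of_directed {s : Set (RoundIdeal B)} (hs : s.Nonempty)
    (hd : DirectedOn (· ≤ ·) s) {a : B.carrier} : a ∈ sSup s ↔ ∃ I ∈ s, a ∈ I := by
  refine ⟨fun h => ?_, fun ⟨I, hI, ha⟩ => mem_sSup_of_mem hI ha⟩
  obtain ⟨I₀, hI₀⟩ := hs
  exact sSup_sub (mkIdeal (fun a => ∃ I ∈ s, a ∈ I) ⟨I₀, hI₀, I₀.bot_mem⟩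
    (fun a b ⟨I, hI, ha⟩ ⟨J, hJ, hb⟩ =>
      have ⟨K, hK, h₁, h₂⟩ := hd I hI J hJ
      ⟨K, hK, sup_mem (h₁ ha) (h₂ hb)⟩)
    (fun a b hle ⟨I, hI, hb⟩ => ⟨I, hI, mem_of_le hle hb⟩)) (fun I hI a ha => ⟨I, hI, ha⟩) h

theorem mem_bot {a : B.carrier} (h : a ∈ (⊥ : RoundIdeal B)) : a = ⊥ := by
  have h' : (⊥ : RoundIdeal B) ≤ below ⊥ := bot_le
  exact le_bot_iff.1 (B.le_of_rel (mem_below.1 (h' h)))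

theorem mem_sup {I J : RoundIdeal B} {a : B.carrier} :
    a ∈ I ⊔ J ↔ ∃ b ∈ I, ∃ c ∈ J, a ≤ b ⊔ c := by
  constructor
  · intro h
    have h' : a ∈ sSup {I, J} := by rwa [sSup_pair]
    have := sSup_sub (I.1 ⊔ J.1) (by
      rintro K (rfl | rfl) x hx
      · exact le_sup_left (a := K.1) (b := J.1) hx
      · exact le_sup_right (a := I.1) (b := K.1) hx) h'
    exact Order.Ideal.mem_sup.1 this
  · rintro ⟨b, hb, c, hc, h⟩
    exact mem_of_le h (sup_mem (le_sup_left (a := I) hb) (le_sup_right (b := J) hc))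

/-- Round ideals form a frame. -/
instance : Order.Frame (RoundIdeal B) :=
  Order.Frame.ofMinimalAxioms
    { inf_sSup_le_iSup_inf := fun I s a ⟨ha, has⟩ => by
        have := sSup_sub (mkIdeal (fun y => ∀ z ∈ I, z ⊓ y ∈ (⨆ J ∈ s, I ⊓ J : RoundIdeal B))
          (fun z _ => by rw [inf_bot_eq]; exact bot_mem _)
          (fun y y' h h' z hz => by rw [inf_sup_left]; exact sup_mem (h z hz) (h' z hz))
          (fun y y' hle h z hz => mem_of_le (inf_le_inf_left z hle) (h z hz)))
          (fun J hJ y hy z hz => le_iSup₂ (f := fun J (_ : J ∈ s) => I ⊓ J) J hJ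
            ⟨mem_of_le inf_le_left hz, mem_of_le inf_le_right hy⟩) has a ha
        rwa [inf_idem] at this }

/-- The well-inside relation on round ideals: `U(I)` meets `J`. -/
theorem wellInside_iff {I J : RoundIdeal B} :
    WellInside I J ↔ ∃ b ∈ J, ∀ a ∈ I, a ≤ b := by
  constructor
  · intro h
    have : (⊤ : B.carrier) ∈ Iᶜ ⊔ J := by rw [h]; trivial
    obtain ⟨c, hc, b, hb, hcb⟩ := mem_sup.1 this
    refine ⟨b, hb, fun a ha => ?_⟩
    have : a ⊓ c ∈ I ⊓ Iᶜ := ⟨mem_of_le inf_le_left ha, mem_of_le inf_le_right hc⟩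
    rw [inf_compl_self] at this
    have hac := mem_bot this
    calc a = a ⊓ (c ⊔ b) := by rw [top_le_iff.1 hcb, inf_top_eq]
      _ ≤ b := by rw [inf_sup_left, hac, bot_sup_eq]; exact inf_le_right
  · rintro ⟨b, hb, h⟩
    obtain ⟨c, hc, hbc⟩ := J.2 b hb
    have hle : below bᶜ ≤ Iᶜ := by
      rw [le_compl_iff_disjoint_left, disjoint_iff_inf_le]
      rintro a ⟨ha, ha'⟩
      have : a ≤ b ⊓ bᶜ := le_inf (h a ha) (B.le_of_rel (mem_below.1 ha'))
      rw [inf_compl_self, le_bot_iff] at this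
      rw [this]; exact bot_mem _
    rw [WellInside, eq_top_iff]
    intro a _
    refine mem_sup.2 ⟨cᶜ, hle (mem_below.2 (B.compl_rel_compl hbc)), c, hc, ?_⟩
    rw [compl_sup_eq_top]; exact le_top

theorem mem_compl {I : RoundIdeal B} {x : B.carrier} :
    x ∈ Iᶜ ↔ ∃ y, B.rel x y ∧ ∀ a ∈ I, a ≤ yᶜ := by
  constructor
  · intro h
    obtain ⟨y, hy, hxy⟩ := Iᶜ.2 x h
    refine ⟨y, hxy, fun a ha => ?_⟩
    have : a ⊓ y ∈ I ⊓ Iᶜ := ⟨mem_of_le inf_le_left ha, mem_of_le (I := Iᶜ) inf_le_right hy⟩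
    rw [inf_compl_self] at this
    exact le_compl_iff_disjoint_right.2 (disjoint_iff.2 (mem_bot this))
  · rintro ⟨y, hxy, h⟩
    have hle : below y ≤ Iᶜ := by
      rw [le_compl_iff_disjoint_left, disjoint_iff_inf_le]
      rintro a ⟨ha, ha'⟩
      have : a ≤ y ⊓ yᶜ := le_inf (B.le_of_rel (mem_below.1 ha')) (h a ha)
      rw [inf_compl_self, le_bot_iff] at this
      rw [this]; exact bot_mem _
    exact hle (mem_below.2 hxy)

theorem wellInside_below {b : B.carrier} {J : RoundIdeal B} (hb : b ∈ J) :
    WellInside (below b) J :=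
  wellInside_iff.2 ⟨b, hb, fun _ ha => B.le_of_rel (mem_below.1 ha)⟩

theorem isCompactElement_top : IsCompactElement (⊤ : RoundIdeal B) := by
  rw [CompleteLattice.isCompactElement_iff_le_of_directed_sSup_le]
  intro s hs hd h
  obtain ⟨I, hI, h1⟩ := (mem_sSup_of_directed hs hd).1 (h (mem_top ⊤))
  exact ⟨I, hI, fun a _ => mem_of_le le_top h1⟩

theorem eq_sSup_wellInside (I : RoundIdeal B) : I = sSup {J | WellInside J I} := by
  refine le_antisymm (fun a ha => ?_) (sSup_le fun J hJ a ha => ?_)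
  · obtain ⟨b, hb, hab⟩ := I.2 a ha
    have hmem : below b ∈ {J | WellInside J I} := wellInside_below hb
    exact mem_sSup_of_mem hmem (mem_below.2 hab)
  · have hJ' : WellInside J I := hJ
    obtain ⟨b, hb, h⟩ := wellInside_iff.1 hJ'
    exact mem_of_le (h a ha) hb

end RoundIdeal

/-- The compact regular frame of round ideals. -/
def roundIdealFrame (B : SubS5S.{u}) : KRFrmP.{u} where
  carrier := RoundIdeal B
  isCompact := RoundIdeal.isCompactElement_top
  isRegular := RoundIdeal.eq_sSup_wellInside

/-- The preframe homomorphism `I ↦ T⁻¹[I]`. -/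
def roundIdealMap {B₁ B₂ : SubS5S.{u}} (T : CompatSub B₁ B₂) :
    PreframeHom (roundIdealFrame B₂) (roundIdealFrame B₁) where
  toFun := fun I : RoundIdeal B₂ => (RoundIdeal.preimage T I.1 : RoundIdeal B₁)
  map_top := by
    refine RoundIdeal.ext fun a => ⟨fun _ => trivial, fun _ => ⟨⊤, trivial, ?_⟩⟩
    exact T.isSubordination.mono le_top T.isSubordination.top_top le_rfl
  map_inf := fun I J => RoundIdeal.ext fun a =>
    ⟨fun ⟨b, hb, h⟩ => ⟨⟨b, hb.1, h⟩, ⟨b, hb.2, h⟩⟩, fun ⟨⟨b, hb, h⟩, ⟨c, hc, h'⟩⟩ =>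
      ⟨b ⊓ c, ⟨RoundIdeal.mem_of_le (I := I) inf_le_left hb,
        RoundIdeal.mem_of_le (I := J) inf_le_right hc⟩, T.isSubordination.inf_right h h'⟩⟩
  map_sSup := fun (s : Set (RoundIdeal B₂)) hs hd => by
    have hm : Monotone fun I : RoundIdeal B₂ => RoundIdeal.preimage T I.1 :=
      fun I J h a ⟨b, hb, hab⟩ => ⟨b, h hb, hab⟩
    refine RoundIdeal.ext fun a => Iff.trans ?_ (RoundIdeal.mem_sSup_of_directed (hs.image _)
      (DirectedOn.image_mono hd hm)).symm
    constructor
    · rintro ⟨b, hb, h⟩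
      obtain ⟨I, hI, hbI⟩ := (RoundIdeal.mem_sSup_of_directed hs hd).1 hb
      exact ⟨_, ⟨I, hI, rfl⟩, ⟨b, hbI, h⟩⟩
    · rintro ⟨_, ⟨I, hI, rfl⟩, ⟨b, hb, h⟩⟩
      exact ⟨b, RoundIdeal.mem_sSup_of_mem hI hb, h⟩

/-- The contravariant functor of round ideals, sending a morphism `T` to `I ↦ T⁻¹[I]`. -/
def RI : SubS5S.{u} ⥤ KRFrmP.{u}ᵒᵖ where
  obj B := Opposite.op (roundIdealFrame B)
  map T := Quiver.Hom.op (X := roundIdealFrame _) (Y := roundIdealFrame _) (roundIdealMap T)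
  map_id B := by
    apply Quiver.Hom.unop_inj
    refine PreframeHom.ext (funext fun I : RoundIdeal B => RoundIdeal.ext fun a => ?_)
    exact ⟨fun ⟨b, hb, h⟩ => RoundIdeal.mem_of_rel (I := I) h hb,
      fun ha => have ⟨b, hb, h⟩ := I.2 a ha; ⟨b, hb, h⟩⟩
  map_comp {B₁ B₂ B₃} T U := by
    apply Quiver.Hom.unop_inj
    refine PreframeHom.ext (funext fun I : RoundIdeal B₃ => RoundIdeal.ext fun a => ?_)
    exact ⟨fun ⟨c, hc, ⟨b, h, h'⟩⟩ => ⟨b, ⟨c, hc, h'⟩, h⟩,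
      fun ⟨b, ⟨c, hc, h'⟩, h⟩ => ⟨c, hc, ⟨b, h, h'⟩⟩⟩

/-! ### Booleanizations of compact regular frames -/

namespace WellInside

variable {L : Type u} [Order.Frame L] {a b c d : L}

theorem le (h : WellInside a b) : a ≤ b := by
  have : a = a ⊓ (aᶜ ⊔ b) := by rw [show aᶜ ⊔ b = ⊤ from h, inf_top_eq]
  rw [this, inf_sup_left, inf_compl_self, bot_sup_eq]
  exact inf_le_right

theorem mono (h : a ≤ b) (h' : WellInside b c) (h'' : c ≤ d) : WellInside a d :=
  top_le_iff.1 ((show bᶜ ⊔ c = ⊤ from h').ge.trans (sup_le_sup (compl_le_compl h) h''))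

theorem inf (h : WellInside a c) (h' : WellInside a d) : WellInside a (c ⊓ d) := by
  rw [WellInside, sup_inf_left, show aᶜ ⊔ c = ⊤ from h, show aᶜ ⊔ d = ⊤ from h', inf_top_eq]

theorem sup (h : WellInside a c) (h' : WellInside b c) : WellInside (a ⊔ b) c := by
  rw [WellInside, compl_sup, sup_inf_right, show aᶜ ⊔ c = ⊤ from h, show bᶜ ⊔ c = ⊤ from h',
    inf_top_eq]

theorem compl_compl (h : WellInside a b) : WellInside aᶜᶜ b := by
  rwa [WellInside, compl_compl_compl]

theorem compl (h : WellInside a b) : WellInside bᶜ aᶜ := by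
  rw [WellInside, sup_comm]
  exact top_le_iff.1 ((show aᶜ ⊔ b = ⊤ from h).ge.trans (sup_le_sup le_rfl le_compl_compl))

theorem bot : WellInside ⊥ a := by rw [WellInside, compl_bot, top_sup_eq]

theorem top : WellInside a ⊤ := sup_top_eq _

end WellInside

namespace KRFrmP

variable {L M : KRFrmP.{u}}

theorem exists_wellInside_of_directed {b : L.carrier} {D : Set L.carrier} (hne : D.Nonempty)
    (hd : DirectedOn (· ≤ ·) D) (h : WellInside b (sSup D)) : ∃ d ∈ D, WellInside b d := by
  have hm : Monotone fun d : L.carrier => bᶜ ⊔ d := fun _ _ h => sup_le_sup le_rfl h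
  have hle : (⊤ : L.carrier) ≤ sSup ((fun d => bᶜ ⊔ d) '' D) := by
    rw [← show bᶜ ⊔ sSup D = ⊤ from h]
    obtain ⟨d, hd⟩ := hne
    refine sup_le (le_sup_left.trans (le_sSup ⟨d, hd, rfl⟩)) (sSup_le fun d hd => ?_)
    exact le_sup_right.trans (le_sSup (Set.mem_image_of_mem (fun d => bᶜ ⊔ d) hd))
  obtain ⟨_, ⟨d, hd, rfl⟩, h⟩ :=
    (CompleteLattice.isCompactElement_iff_le_of_directed_sSup_le _ _).1 L.isCompact _
      (hne.image _) (DirectedOn.image_mono hd hm) hle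
  exact ⟨d, hd, top_le_iff.1 h⟩

/-- The regular elements well inside `a`. -/
def regularBelow (a : L.carrier) : Set L.carrier := {x | xᶜᶜ = x ∧ WellInside x a}

theorem regularBelow_nonempty (a : L.carrier) : (regularBelow a).Nonempty :=
  ⟨⊥, by rw [compl_bot, compl_top], WellInside.bot⟩

theorem regularBelow_directed (a : L.carrier) : DirectedOn (· ≤ ·) (regularBelow a) := by
  rintro x ⟨_, hx⟩ y ⟨_, hy⟩
  exact ⟨(x ⊔ y)ᶜᶜ, ⟨compl_compl_compl _, (hx.sup hy).compl_compl⟩,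
    le_sup_left.trans le_compl_compl, le_sup_right.trans le_compl_compl⟩

theorem sSup_regularBelow (a : L.carrier) : sSup (regularBelow a) = a := by
  refine le_antisymm (sSup_le fun x hx => hx.2.le) ?_
  conv_lhs => rw [L.isRegular a]
  refine sSup_le fun x (hx : WellInside x a) => le_compl_compl.trans (le_sSup ?_)
  exact ⟨compl_compl_compl _, hx.compl_compl⟩

/-- If `b ≺ □ a` then `b ≺ □ c` for some regular `c ≺ a`. -/
theorem exists_between_map (f : PreframeHom L M) {b : M.carrier} {a : L.carrier}
    (h : WellInside b (f.toFun a)) :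
    ∃ c : Heyting.Regular L.carrier, WellInside b (f.toFun c) ∧ WellInside (c : L.carrier) a := by
  rw [← sSup_regularBelow a, f.map_sSup _ (regularBelow_nonempty a) (regularBelow_directed a)] at h
  obtain ⟨_, ⟨c, hc, rfl⟩, h'⟩ := exists_wellInside_of_directed
    ((regularBelow_nonempty a).image _)
    (DirectedOn.image_mono (regularBelow_directed a) f.monotone) h
  exact ⟨⟨c, hc.1⟩, h', hc.2⟩

theorem exists_between {a b : L.carrier} (h : WellInside b a) :
    ∃ c : Heyting.Regular L.carrier, WellInside b (c : L.carrier) ∧ WellInside (c : L.carrier) a :=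
  exists_between_map (𝟙 L : PreframeHom L L) h

theorem relSubordination (f : PreframeHom L M) :
    IsSubordination fun (b : Heyting.Regular M.carrier) (a : Heyting.Regular L.carrier) =>
      WellInside (b : M.carrier) (f.toFun a) where
  bot_bot := WellInside.bot
  top_top := by
    change WellInside _ (f.toFun ⊤)
    rw [f.map_top]; exact WellInside.top
  sup_left h h' := (h.sup h').compl_compl
  inf_right {b a a'} h h' := by
    change WellInside _ (f.toFun ((a : L.carrier) ⊓ a'))
    rw [f.map_inf]; exact h.inf h'
  mono h h' h'' := WellInside.mono h h' (f.monotone h'')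

/-- The booleanization of a compact regular frame, with the restriction of the well-inside
relation. Its elements are the `a` with `a = a**`. -/
def regularAlgebra (L : KRFrmP.{u}) : SubS5S.{u} where
  carrier := Heyting.Regular L.carrier
  rel a b := WellInside (a : L.carrier) (b : L.carrier)
  isSubordination := relSubordination (𝟙 L : PreframeHom L L)
  le_of_rel h := h.le
  compl_rel_compl h := h.compl
  exists_between h := exists_between h

theorem isDeVries_regularAlgebra (L : KRFrmP.{u}) : isDeVries (regularAlgebra L) := by
  constructor
  · intro (a : Heyting.Regular L.carrier) ha
    by_contra hcon
    apply ha
    apply Heyting.Regular.coe_injective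
    change (a : L.carrier) = ⊥
    rw [← sSup_regularBelow (a : L.carrier), ← le_bot_iff]
    refine sSup_le fun x hx => ?_
    by_contra hx0
    refine hcon ⟨(⟨x, hx.1⟩ : Heyting.Regular L.carrier), fun h => hx0 ?_, hx.2⟩
    exact (congrArg Heyting.Regular.val h).le
  · intro (s : Set (Heyting.Regular L.carrier))
    refine ⟨Heyting.Regular.toRegular (sSup (Heyting.Regular.val '' s)), fun a ha => ?_, fun b hb => ?_⟩
    · have : a.val ≤ sSup (Heyting.Regular.val '' s) := le_sSup ⟨a, ha, rfl⟩
      exact this.trans le_compl_compl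
    · refine Heyting.Regular.gi.gc.l_le (sSup_le ?_)
      rintro _ ⟨a, ha, rfl⟩
      exact hb ha

/-- The relation `b ≺ □ a` as a compatible subordination. -/
def regularMap (f : PreframeHom L M) : CompatSub (regularAlgebra M) (regularAlgebra L) where
  rel := fun (b : Heyting.Regular M.carrier) (a : Heyting.Regular L.carrier) =>
    WellInside (b : M.carrier) (f.toFun a)
  isSubordination := relSubordination f
  comp_right := by
    ext b a
    exact ⟨fun ⟨_, h, h'⟩ => h.mono le_rfl (f.monotone h'.le), fun h => exists_between_map f h⟩
  comp_left := by
    ext b a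
    exact ⟨fun ⟨_, h, h'⟩ => WellInside.mono h.le h' le_rfl, fun h => exists_between h⟩

end KRFrmP

/-- The contravariant booleanization functor, sending a morphism `□` to the relation
`b ≺ □ a`. -/
def booleanization : KRFrmP.{u}ᵒᵖ ⥤ DeVS.{u} where
  obj L := ⟨L.unop.regularAlgebra, L.unop.isDeVries_regularAlgebra⟩
  map f := ObjectProperty.homMk (KRFrmP.regularMap f.unop)
  map_id _ := rfl
  map_comp {L M N} f g := by
    apply ObjectProperty.hom_ext
    apply CompatSub.ext
    ext c a
    exact ⟨fun h => KRFrmP.exists_between_map (b := c.val) f.unop h,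
      fun ⟨_, h, h'⟩ => WellInside.mono le_rfl h (f.unop.monotone h'.le)⟩

/-! ### The dual equivalences -/

/-- The morphism `T̂ : B₂ → B₁` associated with `T : B₁ → B₂`. -/
def CompatSub.converse {B₁ B₂ : SubS5S.{u}} (T : CompatSub B₁ B₂) : CompatSub B₂ B₁ where
  rel := hat T.rel
  isSubordination :=
    { bot_bot := by simpa [hat] using T.isSubordination.top_top
      top_top := by simpa [hat] using T.isSubordination.bot_bot
      sup_left := fun h h' => by
        simpa [hat, compl_sup] using T.isSubordination.inf_right h h'
      inf_right := fun h h' => by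
        simpa [hat, compl_inf] using T.isSubordination.sup_left h h'
      mono := fun h h' h'' =>
        T.isSubordination.mono (compl_le_compl h'') h' (compl_le_compl h) }
  comp_right := by
    ext b a
    constructor
    · rintro ⟨c, h, h'⟩
      exact T.left.2 ⟨cᶜ, B₁.compl_rel_compl h', h⟩
    · intro h
      obtain ⟨c, hc, hc'⟩ := T.left.1 h
      refine ⟨cᶜ, by simpa [hat] using hc', ?_⟩
      simpa using B₁.compl_rel_compl hc
  comp_left := by
    ext b a
    constructor
    · rintro ⟨c, h, h'⟩
      exact T.right.2 ⟨cᶜ, h', B₂.compl_rel_compl h⟩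
    · intro h
      obtain ⟨c, hc, hc'⟩ := T.right.1 h
      refine ⟨cᶜ, ?_, by simpa [hat] using hc⟩
      simpa using B₂.compl_rel_compl hc'

namespace RoundIdeal

variable {B : SubS5S.{u}}

/-- Any element of a round ideal `J` lies in a normal round ideal well inside `J`. -/
theorem exists_normal {J : RoundIdeal B} {a : B.carrier} (ha : a ∈ J) :
    ∃ I : Heyting.Regular (RoundIdeal B), a ∈ I.val ∧ WellInside I.val J := by
  obtain ⟨b, hb, hab⟩ := J.2 a ha
  refine ⟨⟨(below b)ᶜᶜ, compl_compl_compl _⟩, ?_, (wellInside_below hb).compl_compl⟩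
  exact (le_compl_compl : below b ≤ _) (mem_below.2 hab)

/-- The relation `Q` given by `a Q I` iff `a ∈ I`. -/
def unitHom (B : SubS5S.{u}) : CompatSub B (roundIdealFrame B).regularAlgebra where
  rel := fun a (I : Heyting.Regular (RoundIdeal B)) => a ∈ I.val
  isSubordination :=
    { bot_bot := bot_mem (B := B) _
      top_top := mem_top (B := B) _
      sup_left := fun {a b} I h h' => sup_mem (B := B) h h'
      inf_right := fun h h' => ⟨h, h'⟩
      mono := fun h h' h'' => h'' (mem_of_le (B := B) h h') }
  comp_right := by
    ext a J
    exact ⟨fun ⟨_, h, h'⟩ => h'.le h, fun h => exists_normal (B := B) h⟩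
  comp_left := by
    ext a J
    exact ⟨fun ⟨_, h, h'⟩ => mem_of_rel (B := B) h h', fun h =>
      have ⟨b, hb, hab⟩ := (show Heyting.Regular (RoundIdeal B) from J).val.2 a h
      ⟨b, hab, hb⟩⟩

theorem unitHom_converse (B : SubS5S.{u}) : (unitHom B).comp (unitHom B).converse =
    CompatSub.id B := by
  apply CompatSub.ext
  ext a b
  constructor
  · rintro ⟨(I : Heyting.Regular (RoundIdeal B)), ha, hb⟩
    have hb' : bᶜ ∈ I.valᶜ := hb
    obtain ⟨c, hc, hI⟩ := mem_compl.1 hb'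
    have := B.compl_rel_compl hc
    rw [compl_compl] at this
    exact B.isSubordination.mono (hI a ha) this le_rfl
  · intro h
    obtain ⟨c, hac, hcb⟩ := B.exists_between h
    refine ⟨(⟨(below c)ᶜᶜ, compl_compl_compl _⟩ : Heyting.Regular (RoundIdeal B)),
      (le_compl_compl : below c ≤ _) (mem_below.2 hac), ?_⟩
    have : bᶜ ∈ (below c)ᶜ := mem_compl.2 ⟨cᶜ, B.compl_rel_compl hcb, fun x hx => by
      rw [compl_compl]; exact B.le_of_rel (mem_below.1 hx)⟩
    exact (le_compl_compl : (below c)ᶜ ≤ _) this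

theorem converse_unitHom (B : SubS5S.{u}) : (unitHom B).converse.comp (unitHom B) =
    CompatSub.id _ := by
  apply CompatSub.ext
  ext (I : Heyting.Regular (RoundIdeal B)) (J : Heyting.Regular (RoundIdeal B))
  refine Iff.trans ?_ (wellInside_iff (I := I.val) (J := J.val)).symm
  constructor
  · rintro ⟨a, ha, haJ⟩
    have ha' : aᶜ ∈ I.valᶜ := ha
    obtain ⟨c, hc, hI⟩ := mem_compl.1 ha'
    refine ⟨a, haJ, fun x hx => (hI x hx).trans ?_⟩
    rw [← compl_compl a]
    exact compl_le_compl (B.le_of_rel hc)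
  · rintro ⟨b, hb, hI⟩
    obtain ⟨a, ha, hba⟩ := J.val.2 b hb
    refine ⟨a, ?_, ha⟩
    exact mem_compl.2 ⟨bᶜ, B.compl_rel_compl hba, fun x hx => by rw [compl_compl]; exact hI x hx⟩

end RoundIdeal

/-- The natural isomorphism `Q`, with `a Q I` iff `a ∈ I`. -/
def unitIso : 𝟭 SubS5S.{u} ≅ RI ⋙ booleanization ⋙ isDeVries.ι :=
  NatIso.ofComponents
    (fun B =>
      { hom := RoundIdeal.unitHom B
        inv := (RoundIdeal.unitHom B).converse
        hom_inv_id := RoundIdeal.unitHom_converse B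
        inv_hom_id := RoundIdeal.converse_unitHom B })
    (fun {B₁ B₂} T => by
      apply CompatSub.ext
      ext a (I : Heyting.Regular (RoundIdeal B₂))
      constructor
      · rintro ⟨b, h, h'⟩
        exact RoundIdeal.exists_normal (J := RoundIdeal.preimage T I.val.1) ⟨b, h', h⟩
      · rintro ⟨J, h, h'⟩
        obtain ⟨b, hb, hab⟩ := WellInside.le h' h
        exact ⟨b, hab, hb⟩)

namespace KRFrmP

/-- An order isomorphism is a preframe isomorphism. -/
def isoOfOrderIso {L M : KRFrmP.{u}} (e : L.carrier ≃o M.carrier) : L ≅ M where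
  hom :=
    { toFun := e
      map_top := e.map_top
      map_inf := e.map_inf
      map_sSup := fun s _ _ => by rw [e.map_sSup, sSup_image] }
  inv :=
    { toFun := e.symm
      map_top := e.symm.map_top
      map_inf := e.symm.map_inf
      map_sSup := fun s _ _ => by rw [e.symm.map_sSup, sSup_image] }
  hom_inv_id := PreframeHom.ext (funext e.symm_apply_apply)
  inv_hom_id := PreframeHom.ext (funext e.apply_symm_apply)

/-- The round ideal of all regular elements well inside `a`. -/
def wellBelow (L : KRFrmP.{u}) (a : L.carrier) : RoundIdeal L.regularAlgebra :=
  ⟨RoundIdeal.mkIdeal (fun b : Heyting.Regular L.carrier => WellInside b.val a) WellInside.bot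
    (fun _ _ h h' => (h.sup h').compl_compl) (fun _ _ h h' => WellInside.mono h h' le_rfl),
    fun _ h => have ⟨c, hc, hc'⟩ := exists_between h; ⟨c, hc', hc⟩⟩

/-- The frame isomorphism `a ↦ {b ∈ 𝔅L | b ≺ a}` from `L` to the round ideals of `𝔅L`. -/
def wellBelowIso (L : KRFrmP.{u}) : L.carrier ≃o RoundIdeal L.regularAlgebra where
  toFun := L.wellBelow
  invFun I := sSup {x | ∃ b : Heyting.Regular L.carrier, b ∈ I.1 ∧ b.val = x}
  left_inv a := by
    refine Eq.trans (congrArg sSup (Set.ext fun x => ?_)) (sSup_regularBelow a)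
    exact ⟨fun ⟨b, hb, hx⟩ => hx ▸ ⟨b.2, hb⟩, fun hx => ⟨⟨x, hx.1⟩, hx.2, rfl⟩⟩
  right_inv I := by
    refine RoundIdeal.ext fun (b : Heyting.Regular L.carrier) => ⟨fun h => ?_, fun h => ?_⟩
    · have hne : {x | ∃ b : Heyting.Regular L.carrier, b ∈ I.1 ∧ b.val = x}.Nonempty :=
        ⟨_, ⟨⊥, RoundIdeal.bot_mem I, rfl⟩⟩
      obtain ⟨_, ⟨c, hc, rfl⟩, hbc⟩ := exists_wellInside_of_directed hne (by
          rintro _ ⟨c, hc, rfl⟩ _ ⟨d, hd, rfl⟩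
          exact ⟨_, ⟨c ⊔ d, RoundIdeal.sup_mem (I := I) hc hd, rfl⟩,
            (le_sup_left : c ≤ c ⊔ d), (le_sup_right : d ≤ c ⊔ d)⟩) h
      exact RoundIdeal.mem_of_rel (I := I) hbc hc
    · obtain ⟨c, hc, hbc⟩ := I.2 b h
      exact WellInside.mono le_rfl hbc (le_sSup ⟨c, hc, rfl⟩)
  map_rel_iff' {a a'} := by
    constructor
    · intro h
      rw [← sSup_regularBelow a]
      refine sSup_le fun x hx => ?_
      have : (⟨x, hx.1⟩ : Heyting.Regular L.carrier) ∈ L.wellBelow a' := h hx.2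
      exact WellInside.le this
    · exact fun h b hb => WellInside.mono le_rfl hb h

end KRFrmP

/-- The natural isomorphism `f`, with `f a = {b ∈ 𝔅L | b ≺ a}`. -/
def counitIso : (booleanization.{u} ⋙ isDeVries.ι) ⋙ RI ≅ 𝟭 KRFrmP.{u}ᵒᵖ :=
  NatIso.ofComponents (fun L => (KRFrmP.isoOfOrderIso L.unop.wellBelowIso).op)
    (fun {L M} f => by
      apply Quiver.Hom.unop_inj
      refine PreframeHom.ext (funext fun a : M.unop.carrier => RoundIdeal.ext
        fun b : Heyting.Regular L.unop.carrier => ?_)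
      change b ∈ RoundIdeal.preimage (KRFrmP.regularMap f.unop) (M.unop.wellBelow a).1 ↔
        WellInside b.val (f.unop.toFun a)
      constructor
      · rintro ⟨c, hc, hc'⟩
        exact WellInside.mono le_rfl hc' (f.unop.monotone (WellInside.le hc))
      · intro h
        obtain ⟨c, hc, hc'⟩ := KRFrmP.exists_between_map f.unop h
        exact ⟨c, hc', hc⟩)

/-- The dual equivalence between `SubS5S` and `KRFrmP` formed by the round ideal functor and the
booleanization functor. -/
def dualEquivalenceSubS5S : SubS5S.{u} ≌ KRFrmP.{u}ᵒᵖ where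
  functor := RI
  inverse := booleanization ⋙ isDeVries.ι
  unitIso := unitIso
  counitIso := counitIso
  functor_unitIso_comp B := by
    apply Quiver.Hom.unop_inj
    refine PreframeHom.ext (funext fun I : RoundIdeal B => RoundIdeal.ext fun a => ?_)
    change a ∈ RoundIdeal.preimage (RoundIdeal.unitHom B) ((roundIdealFrame B).wellBelow I).1 ↔ a ∈ I
    constructor
    · rintro ⟨J, hJ, ha⟩
      exact WellInside.le hJ ha
    · intro h
      obtain ⟨J, ha, hJ⟩ := RoundIdeal.exists_normal (J := I) h
      exact ⟨J, hJ, ha⟩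

/-- The dual equivalence between `DeVS` and `KRFrmP` formed by (the restriction of) the round ideal
functor and the booleanization functor. -/
def dualEquivalenceDeVS : DeVS.{u} ≌ KRFrmP.{u}ᵒᵖ where
  functor := isDeVries.ι ⋙ RI
  inverse := booleanization
  unitIso := NatIso.ofComponents (fun B => isDeVries.isoMk (unitIso.app B.obj))
    (fun T => ObjectProperty.hom_ext _ (unitIso.hom.naturality T.hom))
  counitIso := counitIso
  functor_unitIso_comp B := dualEquivalenceSubS5S.functor_unitIso_comp B.obj

/-! ### Restriction to wide subcategories -/

/-- A dual equivalence `e` between `C` and `D` restricts to a dual equivalence `e'` between the wide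
subcategories of `C` and `D` given by `P` and `Q`: both contravariant functors of `e'` and both
natural isomorphisms of `e'` are restrictions of those of `e`. -/
structure RestrictsTo {C D : Type (u + 1)} [Category.{u} C] [Category.{u} D] (e : C ≌ Dᵒᵖ)
    (P : MorphismProperty C) (Q : MorphismProperty D) [P.IsMultiplicative] [Q.IsMultiplicative]
    (e' : WideSubcategory P ≌ (WideSubcategory Q)ᵒᵖ) : Prop where
  functor_eq : e'.functor ⋙ (wideSubcategoryInclusion Q).op =
    wideSubcategoryInclusion P ⋙ e.functor
  inverse_eq : e'.inverse ⋙ wideSubcategoryInclusion P =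
    (wideSubcategoryInclusion Q).op ⋙ e.inverse
  unit_heq : ∀ X : WideSubcategory P, HEq (e'.unit.app X).hom (e.unit.app X.obj)
  counit_heq : ∀ Y : (WideSubcategory Q)ᵒᵖ,
    HEq (e'.counit.app Y).unop.hom (e.counit.app (Opposite.op Y.unop.obj)).unop

/-!
A compatible subordination `T` is functional exactly when `RI(T)` preserves `⊥` and binary joins,
that is, when `T a ⊥` forces `a = ⊥` and `T a (b ⊔ c)` lets `a` be covered by a part sent to `b`
and a part sent to `c`. Since a preframe homomorphism preserving finite joins preserves all joins,
the functional morphisms are exactly the inverse image under `RI` of the frame homomorphisms. These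
contain all isomorphisms of preframes, which are order isomorphisms, and an equivalence restricts
to wide subcategories whenever one is the inverse image of the other and the latter contains the
isomorphisms.
-/

/-! ### Frame homomorphisms among preframe homomorphisms -/

theorem map_sSup_of_map_sup_of_map_directed_sSup {α β : Type*} [CompleteLattice α]
    [CompleteLattice β] {f : α → β} (map_bot : f ⊥ = ⊥) (map_sup : ∀ a b, f (a ⊔ b) = f a ⊔ f b)
    (map_directed : ∀ d : Set α, d.Nonempty → DirectedOn (· ≤ ·) d → f (sSup d) = sSup (f '' d))
    (s : Set α) : f (sSup s) = sSup (f '' s) := by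
  obtain rfl | hs := s.eq_empty_or_nonempty
  · simpa only [sSup_empty, Set.image_empty] using map_bot
  have sSup_closure : sSup (supClosure s) = sSup s := (isLUB_supClosure.2 (isLUB_sSup s)).sSup_eq
  have closure_le : supClosure s ⊆ {a | f a ≤ sSup (f '' s)} :=
    supClosure_min (fun a ha => le_sSup (Set.mem_image_of_mem f ha))
      fun a ha b hb => (map_sup a b).trans_le (sup_le ha hb)
  apply le_antisymm
  · rw [← sSup_closure, map_directed _ (hs.mono subset_supClosure) supClosed_supClosure.directedOn]
    exact sSup_le (Set.forall_mem_image.2 closure_le)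
  · have hf : Monotone f := fun a b hab => by
      rw [← sup_eq_right.2 hab, map_sup]
      exact le_sup_left
    exact sSup_le (Set.forall_mem_image.2 fun a ha => hf (le_sSup ha))

theorem isFrameHom_iff_map_bot_and_map_sup {L M : KRFrmP.{u}} (f : PreframeHom L M) :
    isFrameHom (X := L) (Y := M) f ↔
      f.toFun ⊥ = ⊥ ∧ ∀ a b, f.toFun (a ⊔ b) = f.toFun a ⊔ f.toFun b := by
  constructor
  · rintro ⟨g, hg⟩
    simp only [← hg]
    exact ⟨map_bot g, map_sup g⟩
  · rintro ⟨map_bot, map_sup⟩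
    exact ⟨{ toFun := f.toFun
             map_inf' := f.map_inf
             map_top' := f.map_top
             map_sSup' := map_sSup_of_map_sup_of_map_directed_sSup map_bot map_sup f.map_sSup },
      fun _ => rfl⟩

theorem isFrameHom_of_isIso {L M : KRFrmP.{u}} (f : L ⟶ M) [IsIso f] : isFrameHom f := by
  let e : L.carrier ≃o M.carrier :=
    Equiv.toOrderIso
      { toFun := PreframeHom.toFun f
        invFun := PreframeHom.toFun (inv f)
        left_inv := congrFun (congrArg PreframeHom.toFun (IsIso.hom_inv_id f))
        right_inv := congrFun (congrArg PreframeHom.toFun (IsIso.inv_hom_id f)) }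
      (PreframeHom.monotone f) (PreframeHom.monotone (inv f))
  exact ⟨(e : FrameHom L.carrier M.carrier), fun _ => rfl⟩

instance isFrameHom_respectsIso : isFrameHom.{u}.RespectsIso :=
  MorphismProperty.respectsIso_of_isStableUnderComposition
    fun _ _ f (_ : IsIso f) => isFrameHom_of_isIso f

/-! ### Functional subordinations in terms of joins -/

theorem IsSubordination.inf {A B : Type u} [BooleanAlgebra A] [BooleanAlgebra B]
    {S : A → B → Prop} (hS : IsSubordination S) {a a' : A} {b b' : B} (h : S a b) (h' : S a' b') :
    S (a ⊓ a') (b ⊓ b') :=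
  hS.inf_right (hS.mono inf_le_left h le_rfl) (hS.mono inf_le_right h' le_rfl)

namespace CompatSub

variable {B₁ B₂ : SubS5S.{u}}

/-- `T` reflects the bottom element; equivalently, `I ↦ T⁻¹[I]` preserves it. -/
def ReflectsBot (T : CompatSub B₁ B₂) : Prop :=
  ∀ ⦃a⦄, T.rel a ⊥ → a = ⊥

/-- `T` splits binary joins: whatever is `T`-below `b ⊔ c` is covered by a part `T`-below `b'` and
a part `T`-below `c'`. The enlargements `b'` and `c'` of `b` and `c` make this equivalent to
`I ↦ T⁻¹[I]` preserving binary joins of round ideals. -/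
def SplitsSup (T : CompatSub B₁ B₂) : Prop :=
  ∀ ⦃a b b' c c'⦄, T.rel a (b ⊔ c) → B₂.rel b b' → B₂.rel c c' →
    ∃ x y, T.rel x b' ∧ T.rel y c' ∧ a ≤ x ⊔ y

variable {T : CompatSub B₁ B₂}

theorem reflectsBot_of_functional (hT : functional (X := B₁) (Y := B₂) T) : T.ReflectsBot := by
  intro a ha
  have hat_bot_bot : hat T.rel ⊥ ⊥ := by
    simpa only [hat, compl_bot] using T.isSubordination.top_top
  exact le_bot_iff.1 (B₁.le_of_rel (hT.1 a ⊥ ⟨⊥, ha, hat_bot_bot⟩))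

theorem splitsSup_of_functional (hT : functional (X := B₁) (Y := B₂) T) : T.SplitsSup := by
  intro a b b' c c' ha hb hc
  obtain ⟨x, hbx, hxb'⟩ := hT.2 b b' hb
  obtain ⟨y, hcy, hyc'⟩ := hT.2 c c' hc
  have hat_sup_sup : hat T.rel (b ⊔ c) (x ⊔ y) := by
    simpa only [hat, compl_sup] using T.isSubordination.inf hbx hcy
  exact ⟨x, y, hxb', hyc', B₁.le_of_rel (hT.1 a (x ⊔ y) ⟨b ⊔ c, ha, hat_sup_sup⟩)⟩

theorem ReflectsBot.rel_of_hat (hT : T.ReflectsBot) {a c : B₁.carrier} {b : B₂.carrier}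
    (hab : T.rel a b) (hbc : hat T.rel b c) : B₁.rel a c := by
  obtain ⟨a', haa', ha'b⟩ := T.left.1 hab
  have rel_bot : T.rel (a' ⊓ cᶜ) ⊥ := by
    simpa only [inf_compl_self] using T.isSubordination.inf ha'b hbc
  have a'_le : a' ≤ c := disjoint_compl_right_iff.1 (disjoint_iff.2 (hT rel_bot))
  exact B₁.isSubordination.mono le_rfl haa' a'_le

theorem SplitsSup.exists_hat (hT : T.SplitsSup) {b b' : B₂.carrier} (h : B₂.rel b b') :
    ∃ a, hat T.rel b a ∧ T.rel a b' := by
  obtain ⟨d, hbd, hdb'⟩ := B₂.exists_between h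
  have top_rel : T.rel ⊤ (d ⊔ dᶜ) := by
    simpa only [sup_compl_eq_top] using T.isSubordination.top_top
  obtain ⟨x, y, hx, hy, hxy⟩ := hT top_rel hdb' (B₂.compl_rel_compl hbd)
  have compl_le : xᶜ ≤ y := codisjoint_iff_compl_le_right.1 (codisjoint_iff_le_sup.2 hxy)
  exact ⟨x, T.isSubordination.mono compl_le hy le_rfl, hx⟩

theorem functional_iff_reflectsBot_and_splitsSup :
    functional (X := B₁) (Y := B₂) T ↔ T.ReflectsBot ∧ T.SplitsSup :=
  ⟨fun hT => ⟨reflectsBot_of_functional hT, splitsSup_of_functional hT⟩,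
    fun ⟨hbot, hsup⟩ => ⟨fun _ _ ⟨_, hab, hbc⟩ => hbot.rel_of_hat hab hbc,
      fun _ _ h => hsup.exists_hat h⟩⟩

end CompatSub

namespace RoundIdeal

variable {B₁ B₂ : SubS5S.{u}} {T : CompatSub B₁ B₂}

theorem preimage_mono {I J : RoundIdeal B₂} (h : I ≤ J) : preimage T I.1 ≤ preimage T J.1 :=
  fun _ ⟨b, hb, hab⟩ => ⟨b, h hb, hab⟩

theorem mem_preimage_below {a : B₁.carrier} {b : B₂.carrier} :
    a ∈ preimage T (below b).1 ↔ T.rel a b := by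
  rw [T.right]
  exact ⟨fun ⟨c, hc, hac⟩ => ⟨c, hac, mem_below.1 hc⟩, fun ⟨c, hac, hc⟩ => ⟨c, mem_below.2 hc, hac⟩⟩

theorem preimage_bot_iff : preimage T (⊥ : RoundIdeal B₂).1 = ⊥ ↔ T.ReflectsBot := by
  constructor
  · intro h a ha
    exact mem_bot (h ▸ (⟨⊥, bot_mem ⊥, ha⟩ : a ∈ preimage T (⊥ : RoundIdeal B₂).1))
  · refine fun hT => le_bot_iff.1 ?_
    rintro a ⟨b, hb, hab⟩
    obtain rfl : b = ⊥ := mem_bot hb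
    rw [hT hab]
    exact bot_mem ⊥

theorem preimage_sup_iff :
    (∀ I J : RoundIdeal B₂, preimage T (I ⊔ J).1 = preimage T I.1 ⊔ preimage T J.1) ↔
      T.SplitsSup := by
  constructor
  · intro h a b b' c c' ha hb hc
    have sup_mem_sup : b ⊔ c ∈ below b' ⊔ below c' :=
      mem_sup.2 ⟨b, mem_below.2 hb, c, mem_below.2 hc, le_rfl⟩
    have mem_preimage_sup : a ∈ preimage T (below b' ⊔ below c').1 := ⟨b ⊔ c, sup_mem_sup, ha⟩
    rw [h] at mem_preimage_sup
    obtain ⟨x, hx, y, hy, hxy⟩ := mem_sup.1 mem_preimage_sup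
    exact ⟨x, y, mem_preimage_below.1 hx, mem_preimage_below.1 hy, hxy⟩
  · intro hT I J
    refine le_antisymm ?_ (sup_le (preimage_mono le_sup_left) (preimage_mono le_sup_right))
    rintro a ⟨d, hd, had⟩
    obtain ⟨b, hb, c, hc, hbc⟩ := mem_sup.1 hd
    obtain ⟨b', hb', hbb'⟩ := I.2 b hb
    obtain ⟨c', hc', hcc'⟩ := J.2 c hc
    obtain ⟨x, y, hx, hy, hxy⟩ := hT (T.isSubordination.mono le_rfl had hbc) hbb' hcc'
    exact mem_sup.2 ⟨x, ⟨b', hb', hx⟩, y, ⟨c', hc', hy⟩, hxy⟩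

end RoundIdeal

theorem isFrameHom_roundIdealMap_iff {B₁ B₂ : SubS5S.{u}} (T : CompatSub B₁ B₂) :
    isFrameHom (X := roundIdealFrame B₂) (Y := roundIdealFrame B₁) (roundIdealMap T) ↔
      functional (X := B₁) (Y := B₂) T :=
  (isFrameHom_iff_map_bot_and_map_sup (roundIdealMap T)).trans <|
    (and_congr RoundIdeal.preimage_bot_iff RoundIdeal.preimage_sup_iff).trans
      CompatSub.functional_iff_reflectsBot_and_splitsSup.symm

theorem functional_eq_inverseImage_RI : functional.{u} = isFrameHom.op.inverseImage RI := by
  ext B₁ B₂ T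
  exact (isFrameHom_roundIdealMap_iff T).symm

/-! ### Restricting dual equivalences to wide subcategories -/

section WideRestriction

universe v₁ v₂ u₁ u₂

variable {C : Type u₁} [Category.{v₁} C] {D : Type u₂} [Category.{v₂} D]
  {P : MorphismProperty C} {Q : MorphismProperty D} [P.IsMultiplicative] [Q.IsMultiplicative]

/-- The restriction to wide subcategories of a contravariant functor written with codomain `Dᵒᵖ`. -/
def wideRestrictionToOp (F : C ⥤ Dᵒᵖ) (hF : P ≤ Q.op.inverseImage F) :
    WideSubcategory P ⥤ (WideSubcategory Q)ᵒᵖ where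
  obj X := .op ⟨(F.obj X.obj).unop⟩
  map {X Y} f := Quiver.Hom.op (X := (⟨(F.obj Y.obj).unop⟩ : WideSubcategory Q))
    (Y := ⟨(F.obj X.obj).unop⟩) ⟨(F.map f.hom).unop, hF _ f.property⟩
  map_id X := Quiver.Hom.unop_inj <| WideSubcategory.hom_ext _ <|
    congrArg Quiver.Hom.unop (F.map_id X.obj)
  map_comp f g := Quiver.Hom.unop_inj <| WideSubcategory.hom_ext _ <|
    congrArg Quiver.Hom.unop (F.map_comp f.hom g.hom)

/-- The restriction to wide subcategories of a contravariant functor written with domain `Dᵒᵖ`. -/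
def wideRestrictionFromOp (G : Dᵒᵖ ⥤ C) (hG : Q.op ≤ P.inverseImage G) :
    (WideSubcategory Q)ᵒᵖ ⥤ WideSubcategory P where
  obj Y := ⟨G.obj (.op Y.unop.obj)⟩
  map f := ⟨G.map f.unop.hom.op, hG _ f.unop.property⟩
  map_id Y := WideSubcategory.hom_ext _ (G.map_id (.op Y.unop.obj))
  map_comp f g := WideSubcategory.hom_ext _ (G.map_comp f.unop.hom.op g.unop.hom.op)

/-- The restriction of a dual equivalence to wide subcategories. Containing all isomorphisms, these
contain the components of the unit and of the counit. -/
def wideRestrictionEquivalence [P.RespectsIso] [Q.RespectsIso] (e : C ≌ Dᵒᵖ)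
    (hF : P ≤ Q.op.inverseImage e.functor) (hG : Q.op ≤ P.inverseImage e.inverse) :
    WideSubcategory P ≌ (WideSubcategory Q)ᵒᵖ where
  functor := wideRestrictionToOp e.functor hF
  inverse := wideRestrictionFromOp e.inverse hG
  unitIso := NatIso.ofComponents
    (fun X => WideSubcategory.isoMk
      (Y := (wideRestrictionToOp e.functor hF ⋙ wideRestrictionFromOp e.inverse hG).obj X)
      (e.unitIso.app X.obj) (P.of_isIso (e.unitIso.app X.obj).hom)
      (P.of_isIso (e.unitIso.app X.obj).inv))
    (fun f => WideSubcategory.hom_ext _ (e.unitIso.hom.naturality f.hom))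
  counitIso := NatIso.ofComponents
    (fun Y => Iso.op <| WideSubcategory.isoMk (X := Y.unop)
      (Y := ((wideRestrictionFromOp e.inverse hG ⋙ wideRestrictionToOp e.functor hF).obj Y).unop)
      (e.counitIso.app (.op Y.unop.obj)).unop
      (Q.of_isIso (e.counitIso.app (.op Y.unop.obj)).unop.hom)
      (Q.of_isIso (e.counitIso.app (.op Y.unop.obj)).unop.inv))
    (fun f => Quiver.Hom.unop_inj <| WideSubcategory.hom_ext _ <|
      congrArg Quiver.Hom.unop (e.counitIso.hom.naturality f.unop.hom.op))
  functor_unitIso_comp X := Quiver.Hom.unop_inj <| WideSubcategory.hom_ext _ <|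
    congrArg Quiver.Hom.unop (e.functor_unitIso_comp X.obj)

end WideRestriction

theorem inverseImage_functor_inverseImage_inverse {C D : Type*} [Category* C] [Category* D]
    (e : C ≌ D) (W : MorphismProperty D) [W.RespectsIso] :
    (W.inverseImage e.functor).inverseImage e.inverse = W := by
  ext X Y f
  exact W.arrow_mk_iso_iff (Arrow.isoMk (e.counitIso.app X) (e.counitIso.app Y))

theorem exists_restrictsTo_of_eq_inverseImage {C D : Type (u + 1)} [Category.{u} C] [Category.{u} D]
    (e : C ≌ Dᵒᵖ) {P : MorphismProperty C} {Q : MorphismProperty D} [P.IsMultiplicative]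
    [Q.IsMultiplicative] [Q.RespectsIso] (h : P = Q.op.inverseImage e.functor) :
    ∃ e' : WideSubcategory P ≌ (WideSubcategory Q)ᵒᵖ, RestrictsTo e P Q e' := by
  have respectsIso : P.RespectsIso := h ▸ inferInstance
  have hG : Q.op ≤ P.inverseImage e.inverse := by
    rw [h, inverseImage_functor_inverseImage_inverse]
  exact ⟨wideRestrictionEquivalence e h.le hG,
    { functor_eq := rfl
      inverse_eq := rfl
      unit_heq := fun _ => HEq.rfl
      counit_heq := fun _ => HEq.rfl }⟩

theorem theoremt :
    (∃ e : SubS5F.{u} ≌ KRFrm.{u}ᵒᵖ,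
      RestrictsTo dualEquivalenceSubS5S.{u} functional isFrameHom e) ∧
    (∃ e : DeVF.{u} ≌ KRFrm.{u}ᵒᵖ,
      RestrictsTo dualEquivalenceDeVS.{u} (functional.inverseImage isDeVries.ι) isFrameHom e) :=
  ⟨exists_restrictsTo_of_eq_inverseImage _ functional_eq_inverseImage_RI,
    exists_restrictsTo_of_eq_inverseImage _
      (congrArg (·.inverseImage isDeVries.ι) functional_eq_inverseImage_RI)⟩
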